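/- Let $n\ge 1$ and $k\ge 0$ be integers. Let $\mathrm{Sym}_n(\mathbb R)$ be the space of real symmetric $n\times n$ matrices and $\mathrm{SSym}_n(\mathbb R)$ its subspace of matrices of trace zero. All smooth functions are complex valued. On $\mathrm{Sym}_n(\mathbb R)$, with coordinates $x_{ij}$ ($i\le j$) and $x_{ji}:=x_{ij}$, let $\frac{\partial}{\partial X}$ be the symmetric matrix of differential operators with diagonal entries $\frac{\partial}{\partial x_{ii}}$ and off-diagonal entries $\frac12\frac{\partial}{\partial x_{ij}}$. The $k$-th Maass–Selberg operator $\delta_k$ on $C^\infty(\mathrm{GL}_n(\mathbb R)/\mathrm O_n(\mathbb R))$ is $$\delta_k f(g\,\mathrm O_n(\mathbb R))=\operatorname{tr}\Big(\Big(\frac{\partial}{\partial X}\Big)^k\Big)\Big|_{X=0} f(g\exp(X)\,\mathrm O_n(\mathbb R)),\qquad X\in \mathrm{Sym}_n(\mathbb R).$$ Let $i:\mathrm{SL}_n(\mathbb R)/\mathrm{SO}_n(\mathbb R)\to \mathrm{GL}_n(\mathbb R)/\mathrm O_n(\mathbb R)$, $g\,\mathrm{SO}_n(\mathbb R)\mapsto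 g\,\mathrm O_n(\mathbb R)$, and let $p:\mathrm{GL}_n(\mathbb R)/\mathrm O_n(\mathbb R)\to \mathrm{SL}_n(\mathbb R)/\mathrm{SO}_n(\mathbb R)$ be given by $g\,\mathrm O_n(\mathbb R)\mapsto \det(g)^{-1/n}g\,\mathrm{SO}_n(\mathbb R)$ for representatives $g$ with $\det g>0$ (every coset has one). For an operator $D$ on $C^\infty(\mathrm{GL}_n(\mathbb R)/\mathrm O_n(\mathbb R))$ its radial part $P(D)$ is the operator on $C^\infty(\mathrm{SL}_n(\mathbb R)/\mathrm{SO}_n(\mathbb R))$ given by $P(D)f=D(f\circ p)\circ i$. On $\mathrm{SSym}_n(\mathbb R)$ let $\frac{\partial}{\partial Y}$ be the matrix of constant coefficient first order differential operators that is the gradient for the inner product $\langle Y,A\rangle=\operatorname{tr}(YA)$: its $(i,j)$ entry is the derivative in the direction of the orthogonal projection $\frac12(E_{ij}+E_{ji})-\frac{\delta_{ij}}{n}\mathbf 1_n$ of the matrix unit $E_{ij}$ to $\mathrm{SSym}_n(\mathbb R)$ (here $\delta_{ij}$ is the Kronecker symbol). Equivalently, $\big(\frac{\partial}{\partial Y}\big)_{ij}e^{\langle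 Y,A\rangle}=a_{ij}e^{\langle Y,A\rangle}$ for all $A=(a_{ij})\in \mathrm{SSym}_n(\mathbb R)$. Then for all $f\in C^\infty(\mathrm{SL}_n(\mathbb R)/\mathrm{SO}_n(\mathbb R))$ and all $g\in\mathrm{SL}_n(\mathbb R)$, $$P(\delta_k)f(g\,\mathrm{SO}_n(\mathbb R))=\operatorname{tr}\Big(\Big(\frac{\partial}{\partial Y}\Big)^k\Big)\Big|_{Y=0} f(g\exp(Y)\,\mathrm{SO}_n(\mathbb R)),\qquad Y\in\mathrm{SSym}_n(\mathbb R).$$ -/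

import Mathlib

open scoped Matrix.Norms.Operator ContDiff MatrixGroups

noncomputable section

namespace MaassSelberg

/-- Real `n × n` matrices. -/
abbrev Mat (n : ℕ) : Type := Matrix (Fin n) (Fin n) ℝ

/-- The orthogonal group `O_n(ℝ)` as a subgroup of `GL_n(ℝ)`. -/
def On (n : ℕ) : Subgroup (GL (Fin n) ℝ) where
  carrier := {g | (g : Mat n) ∈ Matrix.orthogonalGroup (Fin n) ℝ}
  mul_mem' {a b} ha hb := by
    simp only [Set.mem_ofPred_eq, Units.val_mul] at *
    exact mul_mem ha hb
  one_mem' := by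
    simp only [Set.mem_ofPred_eq, Units.val_one]
    exact one_mem _
  inv_mem' {a} ha := by
    have h1 : (a : Mat n) * star (a : Mat n) = 1 := (Matrix.mem_unitaryGroup_iff).1 ha
    have h2 : ((a⁻¹ : GL (Fin n) ℝ) : Mat n) = star (a : Mat n) := by
      calc ((a⁻¹ : GL (Fin n) ℝ) : Mat n)
          = ((a⁻¹ : GL (Fin n) ℝ) : Mat n) * ((a : Mat n) * star (a : Mat n)) := by
            rw [h1, mul_one]
        _ = star (a : Mat n) := by rw [← mul_assoc, Units.inv_mul, one_mul]
    simp only [Set.mem_ofPred_eq, h2]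
    exact Unitary.star_mem ha

/-- The special orthogonal group `SO_n(ℝ)` as a subgroup of `SL_n(ℝ)`. -/
def SOn (n : ℕ) : Subgroup SL(n, ℝ) :=
  (On n).comap Matrix.SpecialLinearGroup.toGL

/-- `Pos_n(ℝ) = GL_n(ℝ) / O_n(ℝ)`. -/
abbrev Pos (n : ℕ) : Type := GL (Fin n) ℝ ⧸ On n

/-- `SPos_n(ℝ) = SL_n(ℝ) / SO_n(ℝ)`. -/
abbrev SPos (n : ℕ) : Type := SL(n, ℝ) ⧸ SOn n

/-- `GL_n^+(ℝ) / SO_n(ℝ)`; an orthogonal matrix of positive determinant lies in `SO_n(ℝ)`. -/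
abbrev PosPlus (n : ℕ) : Type := GL(n, ℝ)⁺ ⧸ (On n).subgroupOf (GL(n, ℝ)⁺)

/-- Smoothness of a function on a group `G` embedded by `ι` as a submanifold of the space of
matrices: locally it is the restriction of a smooth function of matrices. -/
def IsSmooth {n : ℕ} {G : Type*} (ι : G → Mat n) (φ : G → ℂ) : Prop :=
  ∀ g : G, ∃ U : Set (Mat n), IsOpen U ∧ ι g ∈ U ∧
    ∃ Φ : Mat n → ℂ, ContDiffOn ℝ ∞ Φ U ∧ ∀ h : G, ι h ∈ U → φ h = Φ (ι h)

/-- `C^∞(G/K)`: complex functions on `G/K` whose pull-back along the submersion `G → G/K` is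
smooth. -/
def smoothQuot {n : ℕ} {G : Type*} [Group G] (ι : G → Mat n) (K : Subgroup G) :
    Submodule ℂ (G ⧸ K → ℂ) where
  carrier := {f | IsSmooth ι fun g : G => f (g : G ⧸ K)}
  add_mem' {a b} ha hb := by
    intro g
    obtain ⟨U, hU, hg, F, hF, hF'⟩ := ha g
    obtain ⟨V, hV, hg2, H, hH, hH'⟩ := hb g
    refine ⟨U ∩ V, hU.inter hV, ⟨hg, hg2⟩, F + H,
      (hF.mono Set.inter_subset_left).add (hH.mono Set.inter_subset_right), ?_⟩
    intro h hh
    simp [← hF' h hh.1, ← hH' h hh.2]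
  zero_mem' := fun _ => ⟨Set.univ, isOpen_univ, trivial, 0, contDiffOn_const, fun _ _ => rfl⟩
  smul_mem' c a ha := by
    intro g
    obtain ⟨U, hU, hg, F, hF, hF'⟩ := ha g
    refine ⟨U, hU, hg, c • F, hF.const_smul c, ?_⟩
    intro h hh
    simp [← hF' h hh]

/-- `C^∞(GL_n(ℝ)/O_n(ℝ))`. -/
abbrev CPos (n : ℕ) : Submodule ℂ (Pos n → ℂ) :=
  smoothQuot (fun g : GL (Fin n) ℝ => (g : Mat n)) (On n)

/-- `C^∞(SL_n(ℝ)/SO_n(ℝ))`. -/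
abbrev CSPos (n : ℕ) : Submodule ℂ (SPos n → ℂ) :=
  smoothQuot (fun g : SL(n, ℝ) => (g : Mat n)) (SOn n)

/-! ### Constant coefficient differential operators on a real vector space -/

/-- `C^∞(V)`, complex valued. -/
def CInf (V : Type*) [NormedAddCommGroup V] [NormedSpace ℝ V] : Submodule ℂ (V → ℂ) where
  carrier := {F | ContDiff ℝ ∞ F}
  add_mem' {a b} ha hb := by
    simp only [Set.mem_ofPred_eq] at *
    exact ha.add hb
  zero_mem' := by
    simp only [Set.mem_ofPred_eq]
    exact contDiff_const
  smul_mem' c a ha := by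
    simp only [Set.mem_ofPred_eq] at *
    exact ha.const_smul c

theorem mem_CInf {V : Type*} [NormedAddCommGroup V] [NormedSpace ℝ V] {F : V → ℂ} :
    F ∈ CInf V ↔ ContDiff ℝ ∞ F := Iff.rfl

theorem contDiff_CInf {V : Type*} [NormedAddCommGroup V] [NormedSpace ℝ V] (F : CInf V) :
    ContDiff ℝ ∞ F.1 := F.2

/-- The directional derivative `∂_v` as an operator on `C^∞(V)`. -/
def dirDeriv {V : Type*} [NormedAddCommGroup V] [NormedSpace ℝ V] (v : V) :
    Module.End ℂ (CInf V) where
  toFun F := ⟨fun x => fderiv ℝ F.1 x v,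
    ((contDiff_CInf F).fderiv_right (m := ∞) (by simp)).clm_apply contDiff_const⟩
  map_add' F H := by
    ext x
    have hF : DifferentiableAt ℝ F.1 x := (contDiff_CInf F).differentiable (by simp) x
    have hH : DifferentiableAt ℝ H.1 x := (contDiff_CInf H).differentiable (by simp) x
    simp [fderiv_add hF hH]
  map_smul' c F := by
    ext x
    have hF : DifferentiableAt ℝ F.1 x := (contDiff_CInf F).differentiable (by simp) x
    simp [fderiv_const_smul hF c]

/-- Symmetric real matrices. -/
def Sym (n : ℕ) : Submodule ℝ (Mat n) where
  carrier := {X | X.transpose = X}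
  add_mem' ha hb := by
    simp only [Set.mem_ofPred_eq] at *
    rw [Matrix.transpose_add, ha, hb]
  zero_mem' := by simp
  smul_mem' c X hX := by
    simp only [Set.mem_ofPred_eq] at *
    rw [Matrix.transpose_smul, hX]

theorem mem_Sym {n : ℕ} {X : Mat n} : X ∈ Sym n ↔ X.transpose = X := Iff.rfl

/-- Symmetric real matrices of trace zero. -/
def SSym (n : ℕ) : Submodule ℝ (Mat n) :=
  Sym n ⊓ LinearMap.ker (Matrix.traceLinearMap (Fin n) ℝ ℝ)

/-- The direction of the coordinate derivative `∂/∂x_{ij}` on `Sym_n(ℝ)`: raising the coordinate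
`x_{ij} = x_{ji}` changes both entries of the symmetric matrix. -/
def symDir (n : ℕ) (i j : Fin n) : Sym n :=
  if i = j then ⟨Matrix.single i i 1, by simp [mem_Sym]⟩
  else ⟨Matrix.single i j 1 + Matrix.single j i 1, by
    simp [mem_Sym, Matrix.transpose_add, add_comm]⟩

/-- The matrix `∂/∂X` of operators on `C^∞(Sym_n(ℝ))`: the entries are `∂/∂x_{ii}` on the
diagonal and `(1/2) ∂/∂x_{ij}` off it. -/
def dX (n : ℕ) : Matrix (Fin n) (Fin n) (Module.End ℂ (CInf (Sym n))) :=
  Matrix.of fun i j =>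
    if i = j then dirDeriv (symDir n i i) else (1 / 2 : ℂ) • dirDeriv (symDir n i j)

/-- The orthogonal projection, for the inner product `tr(XY)`, of the matrix unit `E_{ij}` to
`SSym_n(ℝ)`. -/
def ssymDir (n : ℕ) (i j : Fin n) : SSym n :=
  ⟨(1 / 2 : ℝ) • (Matrix.single i j 1 + Matrix.single j i 1) -
      (if i = j then (1 / n : ℝ) else 0) • (1 : Mat n), by
    have hn : (n : ℝ) ≠ 0 := by
      have := i.pos
      positivity
    refine Submodule.mem_inf.2 ⟨?_, ?_⟩
    · by_cases h : i = j <;> simp [mem_Sym, Matrix.transpose_add, add_comm, h]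
    · by_cases h : i = j
      · subst h
        simp [Matrix.trace_add, Matrix.trace_sub, Matrix.trace_smul, hn]
        norm_num
      · have h' : j ≠ i := fun e => h e.symm
        simp [Matrix.trace_add, h, h', Matrix.trace_single_eq_of_ne]⟩

/-- The defining property of `ssymDir`; equivalently
`(∂/∂Y)_{ij} e^{tr(YA)} = a_{ij} e^{tr(YA)}` for `A` in `SSym_n(ℝ)`. -/
theorem trace_ssymDir_mul (n : ℕ) (i j : Fin n) (A : SSym n) :
    Matrix.trace ((ssymDir n i j : Mat n) * (A : Mat n)) = (A : Mat n) i j := by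
  obtain ⟨A, hA⟩ := A
  obtain ⟨h1, h2⟩ := Submodule.mem_inf.1 hA
  have h1 : A.transpose = A := h1
  have h2 : A.trace = 0 := by simpa using h2
  have h3 : A j i = A i j := congrFun (congrFun h1 i) j
  have h4 : Matrix.trace (if i = j then (n : ℝ)⁻¹ • A else 0) = 0 := by
    split_ifs <;> simp [h2]
  simp [ssymDir, sub_mul, add_mul, Matrix.trace_add, Matrix.trace_sub, Matrix.trace_single_mul,
    h3, h4]
  ring

/-- The matrix `∂/∂Y` of operators on `C^∞(SSym_n(ℝ))`, the gradient for the inner product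
`tr(XY)`. -/
def dY (n : ℕ) : Matrix (Fin n) (Fin n) (Module.End ℂ (CInf (SSym n))) :=
  Matrix.of fun i j => dirDeriv (ssymDir n i j)

/-! ### Exponential charts -/

/-- `exp(X)` in `GL_n(ℝ)`. -/
def expGL {n : ℕ} (X : Mat n) : GL (Fin n) ℝ := (Matrix.isUnit_exp X).unit

theorem det_exp_of_mem_Sym {n : ℕ} {X : Mat n} (hX : X ∈ Sym n) :
    (NormedSpace.exp X).det = Real.exp X.trace := by
  have hH : X.IsHermitian := by
    have h : X.transpose = X := hX
    simpa [Matrix.IsHermitian, Matrix.conjTranspose_eq_transpose_of_trivial] using h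
  have hs := hH.spectral_theorem
  rw [Unitary.conjStarAlgAut_apply] at hs
  have hD : X.trace = ∑ i, hH.eigenvalues i := by
    simpa using hH.trace_eq_sum_eigenvalues
  set U := hH.eigenvectorUnitary
  let u : (Mat n)ˣ := ⟨(U : Mat n), star (U : Mat n), by simp, by simp⟩
  have he : NormedSpace.exp X = (u : Mat n) *
      NormedSpace.exp (Matrix.diagonal hH.eigenvalues) * ((u⁻¹ : (Mat n)ˣ) : Mat n) := by
    rw [← Matrix.exp_units_conj]
    conv_lhs => rw [hs]
    rfl
  rw [he, Matrix.det_units_conj, Matrix.exp_diagonal, Matrix.det_diagonal, hD, Real.exp_sum]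
  refine Finset.prod_congr rfl fun i _ => ?_
  rw [Pi.coe_exp, Real.exp_eq_exp_ℝ]

/-- `exp(Y)` in `SL_n(ℝ)`, for `Y` symmetric of trace zero. -/
def expSL {n : ℕ} (Y : SSym n) : SL(n, ℝ) :=
  ⟨NormedSpace.exp (Y : Mat n), by
    obtain ⟨h1, h2⟩ := Submodule.mem_inf.1 Y.2
    have h2 : (Y : Mat n).trace = 0 := by simpa using h2
    rw [det_exp_of_mem_Sym h1, h2, Real.exp_zero]⟩

theorem contDiff_exp_mat (n : ℕ) : ContDiff ℝ ∞ (NormedSpace.exp : Mat n → Mat n) :=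
  contDiff_iff_contDiffAt.2 fun x => (NormedSpace.exp_analytic (𝕂 := ℝ) x).contDiffAt

/-- `X ↦ f(g exp(X) O_n(ℝ))` on `Sym_n(ℝ)`, as a function of `f`. -/
def chartPos {n : ℕ} (g : GL (Fin n) ℝ) : CPos n →ₗ[ℂ] CInf (Sym n) where
  toFun f := ⟨fun X => f.1 ((g * expGL (X : Mat n) : GL (Fin n) ℝ) : Pos n), by
    refine mem_CInf.2 <| contDiff_iff_contDiffAt.2 fun X => ?_
    obtain ⟨U, hU, hg, F, hF, hF'⟩ := f.2 (g * expGL (X : Mat n))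
    have hc : ContDiff ℝ ∞ fun Z : Sym n => (g : Mat n) * NormedSpace.exp (Z : Mat n) :=
      contDiff_const.mul ((contDiff_exp_mat n).comp (Sym n).subtypeL.contDiff)
    have hX : (g : Mat n) * NormedSpace.exp (X : Mat n) ∈ U := hg
    have hcomp : ContDiffAt ℝ ∞ (fun Z : Sym n => F ((g : Mat n) * NormedSpace.exp (Z : Mat n))) X :=
      ContDiffAt.comp X (hF.contDiffAt (hU.mem_nhds hX)) hc.contDiffAt
    refine hcomp.congr_of_eventuallyEq ?_
    filter_upwards [hc.continuous.continuousAt.preimage_mem_nhds (hU.mem_nhds hX)] with Z hZ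
    exact hF' (g * expGL (Z : Mat n)) hZ⟩
  map_add' _ _ := rfl
  map_smul' _ _ := rfl

/-- `Y ↦ f(g exp(Y) SO_n(ℝ))` on `SSym_n(ℝ)`, as a function of `f`. -/
def chartSPos {n : ℕ} (g : SL(n, ℝ)) : CSPos n →ₗ[ℂ] CInf (SSym n) where
  toFun f := ⟨fun Y => f.1 ((g * expSL Y : SL(n, ℝ)) : SPos n), by
    refine mem_CInf.2 <| contDiff_iff_contDiffAt.2 fun X => ?_
    obtain ⟨U, hU, hg, F, hF, hF'⟩ := f.2 (g * expSL X)
    have hc : ContDiff ℝ ∞ fun Z : SSym n => (g : Mat n) * NormedSpace.exp (Z : Mat n) :=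
      contDiff_const.mul ((contDiff_exp_mat n).comp (SSym n).subtypeL.contDiff)
    have hX : (g : Mat n) * NormedSpace.exp (X : Mat n) ∈ U := hg
    have hcomp : ContDiffAt ℝ ∞
        (fun Z : SSym n => F ((g : Mat n) * NormedSpace.exp (Z : Mat n))) X :=
      ContDiffAt.comp X (hF.contDiffAt (hU.mem_nhds hX)) hc.contDiffAt
    refine hcomp.congr_of_eventuallyEq ?_
    filter_upwards [hc.continuous.continuousAt.preimage_mem_nhds (hU.mem_nhds hX)] with Z hZ
    exact hF' (g * expSL Z) hZ⟩
  map_add' _ _ := rfl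
  map_smul' _ _ := rfl

/-! ### The Maass-Selberg operators -/

/-- Composition with a linear map, as an operator. -/
def compL {V : Type*} [NormedAddCommGroup V] [NormedSpace ℝ V] 
    [FiniteDimensional ℝ V] (L : V →ₗ[ℝ] V) : Module.End ℂ (CInf V) where
  toFun F := ⟨fun x => F.1 (L x), 
    mem_CInf.2 ((contDiff_CInf F).comp L.toContinuousLinearMap.contDiff)⟩
  map_add' _ _ := rfl
  map_smul' _ _ := rfl

theorem dirDeriv_mul_compL {V : Type*} [NormedAddCommGroup V] [NormedSpace ℝ V]
    [FiniteDimensional ℝ V] (L : V →ₗ[ℝ] V) (v : V) : dirDeriv v * compL L = compL L * dirDeriv (L v) := by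
  ext F x
  have hF : DifferentiableAt ℝ F.1 (L x) := (contDiff_CInf F).differentiable (by simp) (L x)
  have h : fderiv ℝ (fun y => F.1 (L y)) x = (fderiv ℝ F.1 (L x)).comp L.toContinuousLinearMap := by
    have := (hF.hasFDerivAt.comp x L.toContinuousLinearMap.hasFDerivAt).fderiv
    exact this
  change fderiv ℝ (fun y => F.1 (L y)) x v = fderiv ℝ F.1 (L x) (L v)
  rw [h]
  rfl

/-- The direction `(E_{ij} + E_{ji}) / 2` of the `(i, j)` entry of `∂/∂X`. -/
def symDirHalf (n : ℕ) (i j : Fin n) : Sym n :=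
  ⟨(1 / 2 : ℝ) • (Matrix.single i j 1 + Matrix.single j i 1), by
    simp [mem_Sym, Matrix.transpose_add, add_comm]⟩

theorem dX_apply (n : ℕ) (i j : Fin n) : dX n i j = dirDeriv (symDirHalf n i j) := by
  by_cases h : i = j
  · subst h
    have : symDirHalf n i i = symDir n i i := by
      apply Subtype.ext
      simp only [symDirHalf, symDir, if_true, ← two_smul ℝ, smul_smul]
      norm_num
    simp [dX, this]
  · have : symDirHalf n i j = (1 / 2 : ℝ) • symDir n i j := by
      apply Subtype.ext
      simp [symDirHalf, symDir, h]
    rw [this]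
    ext F x
    simp [dX, h, dirDeriv]

/-- Conjugation by `u` with inverse `uᵀ`, on symmetric matrices. -/
def conjSym {n : ℕ} (u : Mat n) : Sym n →ₗ[ℝ] Sym n :=
    { toFun := fun X => ⟨u * (X : Mat n) * u.transpose, by
        have h : (X : Mat n).transpose = X := X.2
        rw [mem_Sym, Matrix.transpose_mul, Matrix.transpose_mul, Matrix.transpose_transpose, h,
          mul_assoc]⟩
      map_add' := fun X Y => by
        apply Subtype.ext
        simp [mul_add, add_mul]
      map_smul' := fun c X => by
        apply Subtype.ext
        simp }

theorem conjSym_symDirHalf {n : ℕ} (u : Mat n) (i j : Fin n) :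
    conjSym u (symDirHalf n i j) = ∑ a, ∑ b, (u a i * u b j) • symDirHalf n a b := by
  apply Subtype.ext
  ext c d
  have h1 : ∀ i j : Fin n, (u * Matrix.single i j (1 : ℝ) * u.transpose) c d = u c i * u d j := by
    intro i j
    simp [Matrix.mul_apply, Matrix.single_apply, ite_and]
  have h2 : (conjSym u (symDirHalf n i j) : Mat n) =
      (1 / 2 : ℝ) • (u * Matrix.single i j (1 : ℝ) * u.transpose +
        u * Matrix.single j i (1 : ℝ) * u.transpose) := by
    change u * ((1 / 2 : ℝ) • (Matrix.single i j (1 : ℝ) + Matrix.single j i 1)) * u.transpose = _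
    rw [mul_smul_comm, smul_mul_assoc, mul_add, add_mul]
  rw [h2, Matrix.smul_apply, Matrix.add_apply, h1, h1]
  simp only [AddSubmonoidClass.coe_finsetSum, SetLike.val_smul, symDirHalf, Matrix.sum_apply,
    Matrix.smul_apply, Matrix.add_apply, Matrix.single_apply, smul_eq_mul, mul_add,
    Finset.sum_add_distrib, ite_and, mul_ite, mul_one, mul_zero]
  simp
  ring

theorem dirDeriv_sum_smul {V ι : Type*} [NormedAddCommGroup V] [NormedSpace ℝ V] (s : Finset ι)
    (c : ι → ℝ) (v : ι → V) :
    dirDeriv (∑ a ∈ s, c a • v a) = ∑ a ∈ s, (c a : ℂ) • dirDeriv (v a) := by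
  ext F x
  have h : (((∑ a ∈ s, (c a : ℂ) • dirDeriv (v a)) F : CInf V) : V → ℂ) x =
      ∑ a ∈ s, (c a : ℂ) * fderiv ℝ F.1 x (v a) := by
    rw [LinearMap.sum_apply, AddSubmonoidClass.coe_finsetSum, Finset.sum_apply]
    rfl
  rw [h]
  change fderiv ℝ F.1 x (∑ a ∈ s, c a • v a) = _
  rw [map_sum]
  simp

theorem pow_intertwine {n : ℕ} {R : Type*} [Ring R] (A B : Matrix (Fin n) (Fin n) R) (C : R)
    (h : ∀ i j, A i j * C = C * B i j) (k : ℕ) (i j : Fin n) :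
    (A ^ k) i j * C = C * (B ^ k) i j := by
  induction k generalizing i j with
  | zero => by_cases hij : i = j <;> simp [hij]
  | succ k ih =>
    rw [pow_succ, pow_succ, Matrix.mul_apply, Matrix.mul_apply, Finset.sum_mul, Finset.mul_sum]
    refine Finset.sum_congr rfl fun l _ => ?_
    rw [mul_assoc, h, ← mul_assoc, ih, mul_assoc]

theorem trace_pow_commute {n : ℕ} {R : Type*} [Ring R] (φ : ℝ →+* R)
    (hφ : ∀ (x : ℝ) (T : R), φ x * T = T * φ x) (D : Matrix (Fin n) (Fin n) R) (C : R)
    {u : Mat n} (hu : u * u.transpose = 1)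
    (h : ∀ i j, D i j * C = C * ∑ b, ∑ a, φ (u a i * u b j) * D a b) (k : ℕ) :
    (D ^ k).trace * C = C * (D ^ k).trace := by
  obtain ⟨U, hUdef⟩ : ∃ U : Matrix (Fin n) (Fin n) R, U = u.map φ := ⟨_, rfl⟩
  have hUa : ∀ i j, U i j = φ (u i j) := fun i j => by rw [hUdef, Matrix.map_apply]
  have hU : U * U.transpose = 1 := by
    have := congrArg (fun M : Mat n => M.map φ) hu
    simpa [hUdef, Matrix.map_mul, Matrix.transpose_map] using this
  have hU' : U.transpose * U = 1 := by
    have := congrArg (fun M : Mat n => M.map φ) (mul_eq_one_comm.1 hu)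
    simpa [hUdef, Matrix.map_mul, Matrix.transpose_map] using this
  have h1 : ∀ i j, D i j * C = C * (U.transpose * D * U) i j := by
    intro i j
    rw [h, Matrix.mul_apply]
    congr 1
    refine Finset.sum_congr rfl fun b _ => ?_
    rw [Matrix.mul_apply, Finset.sum_mul]
    refine Finset.sum_congr rfl fun a _ => ?_
    rw [Matrix.transpose_apply, hUa, hUa, mul_assoc, ← hφ, ← mul_assoc, ← map_mul]
  have h2 : (U.transpose * D * U) ^ k = U.transpose * D ^ k * U := by
    induction k with
    | zero => simp [hU']
    | succ k ih =>
      rw [pow_succ, ih, pow_succ]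
      calc U.transpose * D ^ k * U * (U.transpose * D * U)
          = U.transpose * D ^ k * (U * U.transpose) * D * U := by
            simp only [mul_assoc]
        _ = _ := by rw [hU, mul_one, mul_assoc U.transpose]
  have h3 : (U.transpose * D ^ k * U).trace = (D ^ k).trace := by
    calc (U.transpose * D ^ k * U).trace = ((D ^ k * U) * U.transpose).trace := by
          rw [mul_assoc]
          simp only [Matrix.trace, Matrix.diag_apply]
          rw [Finset.sum_congr rfl fun i _ => Matrix.mul_apply (M := U.transpose),
            Finset.sum_congr rfl fun i _ => Matrix.mul_apply (M := D ^ k * U), Finset.sum_comm]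
          refine Finset.sum_congr rfl fun a _ => Finset.sum_congr rfl fun i _ => ?_
          rw [Matrix.transpose_apply, hUa, hφ]
      _ = _ := by rw [mul_assoc, hU, mul_one]
  calc (D ^ k).trace * C
      = ∑ i, (D ^ k) i i * C := Finset.sum_mul _ _ _
    _ = ∑ i, C * ((U.transpose * D * U) ^ k) i i :=
        Finset.sum_congr rfl fun i _ => pow_intertwine _ _ _ h1 k i i
    _ = C * ((U.transpose * D * U) ^ k).trace := (Finset.mul_sum _ _ _).symm
    _ = C * (D ^ k).trace := by rw [h2, h3]

theorem trace_dX_pow_compL {n : ℕ} (k : ℕ) {u : Mat n} (hu : u * u.transpose = 1) :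
    (dX n ^ k).trace * compL (conjSym u) = compL (conjSym u) * (dX n ^ k).trace := by
  refine trace_pow_commute
    ((algebraMap ℂ (Module.End ℂ (CInf (Sym n)))).comp (algebraMap ℝ ℂ))
    (fun x T => Algebra.commutes (x : ℂ) T) (dX n) (compL (conjSym u)) hu (fun i j => ?_) k
  refine (congrArg (· * compL (conjSym u)) (dX_apply n i j)).trans ?_
  refine (dirDeriv_mul_compL (conjSym u) (symDirHalf n i j)).trans ?_
  refine congrArg (fun T => compL (conjSym u) * T) ?_
  rw [conjSym_symDirHalf, ← Finset.sum_product', dirDeriv_sum_smul, Finset.sum_product,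
    Finset.sum_comm]
  refine Finset.sum_congr rfl fun b _ => Finset.sum_congr rfl fun a _ => ?_
  rw [dX_apply]
  exact Algebra.smul_def _ _

theorem chartPos_mul_orthogonal {n : ℕ} (g u : GL (Fin n) ℝ) (hu : u ∈ On n) (f : CPos n) :
    chartPos (g * u) f = compL (conjSym (u : Mat n)) (chartPos g f) := by
  apply Subtype.ext
  funext X
  change f.1 ((g * u * expGL (X : Mat n) : GL (Fin n) ℝ) : Pos n) =
    f.1 ((g * expGL ((u : Mat n) * (X : Mat n) * (u : Mat n).transpose) : GL (Fin n) ℝ) : Pos n)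
  have hu1 : (u : Mat n) * (u : Mat n).transpose = 1 := (Matrix.mem_orthogonalGroup_iff _ _).1 hu
  have hinv : ((u⁻¹ : GL (Fin n) ℝ) : Mat n) = (u : Mat n).transpose := by
    calc ((u⁻¹ : GL (Fin n) ℝ) : Mat n)
        = ((u⁻¹ : GL (Fin n) ℝ) : Mat n) * ((u : Mat n) * (u : Mat n).transpose) := by
          rw [hu1, mul_one]
      _ = _ := by rw [← mul_assoc, Units.inv_mul, one_mul]
  have he : expGL ((u : Mat n) * (X : Mat n) * (u : Mat n).transpose) =
      u * expGL (X : Mat n) * u⁻¹ := by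
    apply Units.ext
    change NormedSpace.exp ((u : Mat n) * (X : Mat n) * (u : Mat n).transpose) =
      (u : Mat n) * NormedSpace.exp (X : Mat n) * ((u⁻¹ : GL (Fin n) ℝ) : Mat n)
    rw [← hinv, Matrix.exp_units_conj]
  rw [he]
  have hq : ((g * u * expGL (X : Mat n) : GL (Fin n) ℝ) : Pos n) =
      ((g * (u * expGL (X : Mat n) * u⁻¹) : GL (Fin n) ℝ) : Pos n) := by
    rw [QuotientGroup.eq]
    have h5 : (g * u * expGL (X : Mat n))⁻¹ * (g * (u * expGL (X : Mat n) * u⁻¹)) = u⁻¹ := by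
      group
    rw [h5]
    exact inv_mem hu
  rw [hq]

/-- The value of `δ_k f` at `g O_n(ℝ)`, well defined by orthogonal invariance. -/
def deltaFun {n : ℕ} (k : ℕ) (f : CPos n) : Pos n → ℂ :=
  Quotient.lift (fun g : GL (Fin n) ℝ => ((dX n ^ k).trace (chartPos g f)).1 0) (by
    intro a b hab
    have hu : a⁻¹ * b ∈ On n := QuotientGroup.leftRel_apply.1 hab
    have hu1 := (Matrix.mem_orthogonalGroup_iff _ _).1 hu
    have hb : chartPos b f =
        compL (conjSym ((a⁻¹ * b : GL (Fin n) ℝ) : Mat n)) (chartPos a f) := by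
      rw [← chartPos_mul_orthogonal a _ hu f, mul_inv_cancel_left]
    have hc := congrArg (fun T => (T (chartPos a f)).1 0) (trace_dX_pow_compL k hu1)
    change ((dX n ^ k).trace (chartPos a f)).1 0 = ((dX n ^ k).trace (chartPos b f)).1 0
    rw [hb]
    refine Eq.trans ?_ hc.symm
    change _ = ((dX n ^ k).trace (chartPos a f)).1 (conjSym _ 0)
    rw [map_zero])

theorem jointly_smooth_dirDeriv {n : ℕ} {V : Type*} [NormedAddCommGroup V] [NormedSpace ℝ V]
    {Ω : Set (Mat n)} (hΩ : IsOpen Ω) (Φ : Mat n → CInf V) (v : V)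
    (hΦ : ContDiffOn ℝ ∞ (fun q : Mat n × V => (Φ q.1).1 q.2) (Ω ×ˢ Set.univ)) :
    ContDiffOn ℝ ∞ (fun q : Mat n × V => (dirDeriv v (Φ q.1)).1 q.2) (Ω ×ˢ Set.univ) := by
  have ho : IsOpen (Ω ×ˢ (Set.univ : Set V)) := hΩ.prod isOpen_univ
  have h1 := (hΦ.fderiv_of_isOpen (m := ∞) ho (by simp)).clm_apply
    (contDiffOn_const (c := ((0 : Mat n), v)))
  refine h1.congr fun q hq => ?_
  have hd : HasFDerivAt (fun q : Mat n × V => (Φ q.1).1 q.2)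
      (fderiv ℝ (fun q : Mat n × V => (Φ q.1).1 q.2) (q.1, q.2)) (q.1, q.2) :=
    ((hΦ.contDiffAt (ho.mem_nhds hq)).differentiableAt (by simp)).hasFDerivAt
  have h2 := hd.comp q.2 (hasFDerivAt_prodMk_right q.1 q.2)
  have h3 : fderiv ℝ (Φ q.1).1 q.2 = _ := h2.fderiv
  change fderiv ℝ (Φ q.1).1 q.2 v = _
  rw [h3]
  rfl

theorem jointly_smooth_dX_pow {n : ℕ} {Ω : Set (Mat n)} (hΩ : IsOpen Ω) (k : ℕ) (i j : Fin n)
    (Φ : Mat n → CInf (Sym n))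
    (hΦ : ContDiffOn ℝ ∞ (fun q : Mat n × Sym n => (Φ q.1).1 q.2) (Ω ×ˢ Set.univ)) :
    ContDiffOn ℝ ∞ (fun q : Mat n × Sym n => ((dX n ^ k) i j (Φ q.1)).1 q.2)
      (Ω ×ˢ Set.univ) := by
  induction k generalizing i j Φ with
  | zero =>
    by_cases h : i = j
    · subst h
      simpa using hΦ
    · simpa [h] using contDiffOn_const
  | succ k ih =>
    have h1 : ∀ q : Mat n × Sym n, ((dX n ^ (k + 1)) i j (Φ q.1)).1 q.2 =
        ∑ l, ((dX n ^ k) i l (dirDeriv (symDirHalf n l j) (Φ q.1))).1 q.2 := by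
      intro q
      rw [pow_succ, Matrix.mul_apply, LinearMap.sum_apply, AddSubmonoidClass.coe_finsetSum,
        Finset.sum_apply]
      refine Finset.sum_congr rfl fun l _ => ?_
      rw [dX_apply]
      rfl
    refine ContDiffOn.congr ?_ fun q _ => h1 q
    exact ContDiffOn.sum fun l _ =>
      ih i l (fun M => dirDeriv (symDirHalf n l j) (Φ M)) (jointly_smooth_dirDeriv hΩ Φ _ hΦ)

theorem deltaFun_mem {n : ℕ} (k : ℕ) (f : CPos n) : deltaFun k f ∈ CPos n := by
  classical
  let ft : Mat n → ℂ := fun M => if h : IsUnit M then f.1 (h.unit : GL (Fin n) ℝ) else 0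
  have hft : ∀ g : GL (Fin n) ℝ, ft (g : Mat n) = f.1 (g : Pos n) := by
    intro g
    simp [ft, g.isUnit]
  have ho : IsOpen {M : Mat n | IsUnit M} := Units.isOpen
  have hs : ContDiffOn ℝ ∞ ft {M : Mat n | IsUnit M} := by
    intro M hM
    obtain ⟨g, rfl⟩ : IsUnit M := hM
    obtain ⟨U, hU, hg, F, hF, hF'⟩ := f.2 g
    refine ContDiffAt.contDiffWithinAt ?_
    refine (hF.contDiffAt (hU.mem_nhds hg)).congr_of_eventuallyEq ?_
    filter_upwards [hU.mem_nhds hg, ho.mem_nhds g.isUnit] with N hN hN'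
    obtain ⟨h, rfl⟩ : IsUnit N := hN'
    rw [hft, ← hF' h hN]
  let Φ : Mat n → CInf (Sym n) := fun M => if h : IsUnit M then chartPos h.unit f else 0
  have hΦ1 : ∀ g : GL (Fin n) ℝ, Φ (g : Mat n) = chartPos g f := by
    intro g
    simp [Φ, g.isUnit]
  have hΦ : ContDiffOn ℝ ∞ (fun q : Mat n × Sym n => (Φ q.1).1 q.2)
      ({M : Mat n | IsUnit M} ×ˢ Set.univ) := by
    have hc : ContDiff ℝ ∞ fun q : Mat n × Sym n => q.1 * NormedSpace.exp (q.2 : Mat n) :=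
      contDiff_fst.mul ((contDiff_exp_mat n).comp ((Sym n).subtypeL.contDiff.comp contDiff_snd))
    refine (hs.comp hc.contDiffOn fun q hq => ?_).congr fun q hq => ?_
    · exact IsUnit.mul hq.1 (Matrix.isUnit_exp _)
    · obtain ⟨M, X⟩ := q
      obtain ⟨g, rfl⟩ : IsUnit M := hq.1
      change (Φ (g : Mat n)).1 X = ft ((g * expGL (X : Mat n) : GL (Fin n) ℝ) : Mat n)
      rw [hΦ1, hft]
      rfl
  intro g
  refine ⟨{M : Mat n | IsUnit M}, ho, g.isUnit, fun M => ((dX n ^ k).trace (Φ M)).1 0, ?_, ?_⟩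
  · have h1 : ∀ M : Mat n, ((dX n ^ k).trace (Φ M)).1 0 =
        ∑ i, ((dX n ^ k) i i (Φ M)).1 0 := by
      intro M
      rw [Matrix.trace, LinearMap.sum_apply, AddSubmonoidClass.coe_finsetSum, Finset.sum_apply]
      rfl
    refine ContDiffOn.congr ?_ fun M _ => h1 M
    refine ContDiffOn.sum fun i _ => ?_
    exact (jointly_smooth_dX_pow ho k i i Φ hΦ).comp
      (contDiff_id.prodMk contDiff_const).contDiffOn fun M hM => ⟨hM, trivial⟩
  · intro h _
    change ((dX n ^ k).trace (chartPos h f)).1 0 = ((dX n ^ k).trace (Φ (h : Mat n))).1 0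
    rw [hΦ1]

/-- The Maass-Selberg operator `δ_k` on `C^∞(GL_n(ℝ)/O_n(ℝ))`, given by
`δ_k f(g O_n(ℝ)) = tr((∂/∂X)^k)|_{X=0} f(g exp(X) O_n(ℝ))`. -/
def delta (n k : ℕ) : Module.End ℂ (CPos n) where
  toFun f := ⟨deltaFun k f, deltaFun_mem k f⟩
  map_add' a b := by
    apply Subtype.ext
    funext x
    induction x using QuotientGroup.induction_on with
    | H g =>
      change ((dX n ^ k).trace (chartPos g (a + b))).1 0 =
        ((dX n ^ k).trace (chartPos g a)).1 0 + ((dX n ^ k).trace (chartPos g b)).1 0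
      rw [map_add, map_add]
      rfl
  map_smul' c a := by
    apply Subtype.ext
    funext x
    induction x using QuotientGroup.induction_on with
    | H g =>
      change ((dX n ^ k).trace (chartPos g (c • a))).1 0 =
        c * ((dX n ^ k).trace (chartPos g a)).1 0
      rw [map_smul, map_smul]
      rfl

/-! ### The maps `i` and `p` and radial parts -/

/-- `i : SL_n(ℝ)/SO_n(ℝ) → GL_n(ℝ)/O_n(ℝ)`, `g SO_n(ℝ) ↦ g O_n(ℝ)`. -/
def iMap (n : ℕ) : SPos n → Pos n :=
  Quotient.map' (fun g : SL(n, ℝ) => Matrix.SpecialLinearGroup.toGL g) (by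
    intro a b hab
    rw [QuotientGroup.leftRel_apply] at hab ⊢
    have h : Matrix.SpecialLinearGroup.toGL (a⁻¹ * b) ∈ On n := hab
    rwa [map_mul, map_inv] at h)

/-- `GL_n^+(ℝ)/SO_n(ℝ) → GL_n(ℝ)/O_n(ℝ)`, `g SO_n(ℝ) ↦ g O_n(ℝ)`. -/
def jMap (n : ℕ) : PosPlus n → Pos n :=
  Quotient.map' (fun g : GL(n, ℝ)⁺ => (g : GL (Fin n) ℝ)) (by
    intro a b hab
    rw [QuotientGroup.leftRel_apply] at hab ⊢
    exact hab)

/-- Every coset of `O_n(ℝ)` contains a matrix of positive determinant. -/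
theorem exists_orthogonal_det_pos {n : ℕ} (g : GL (Fin n) ℝ) :
    ∃ s ∈ On n, 0 < ((g * s : GL (Fin n) ℝ) : Mat n).det := by
  have hg : (g : Mat n).det ≠ 0 := ((Matrix.isUnit_iff_isUnit_det _).1 g.isUnit).ne_zero
  rcases lt_or_gt_of_ne hg with h | h
  · rcases Nat.eq_zero_or_pos n with rfl | hn
    · simp only [Matrix.det_isEmpty] at h
      linarith
    · let d : Mat n := Matrix.diagonal (Function.update 1 ⟨0, hn⟩ (-1))
      have hd : d * d = 1 := by
        rw [Matrix.diagonal_mul_diagonal, ← Matrix.diagonal_one]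
        congr 1
        funext i
        by_cases hi : i = ⟨0, hn⟩
        · subst hi
          simp
        · simp [Function.update_of_ne hi]
      have hdet : d.det = -1 := by
        rw [Matrix.det_diagonal, Finset.prod_update_of_mem (Finset.mem_univ _)]
        simp
      refine ⟨⟨d, d, hd, hd⟩, ?_, ?_⟩
      · refine (Matrix.mem_orthogonalGroup_iff _ _).2 ?_
        change d * d.transpose = 1
        rw [Matrix.diagonal_transpose]
        exact hd
      · change 0 < ((g : Mat n) * d).det
        rw [Matrix.det_mul, hdet]
        linarith
  · exact ⟨1, one_mem _, by simpa using h⟩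

theorem jMap_bijective (n : ℕ) : Function.Bijective (jMap n) := by
  constructor
  · intro x y
    induction x using QuotientGroup.induction_on with
    | H a =>
      induction y using QuotientGroup.induction_on with
      | H b =>
        intro h
        have h1 : (((a : GL (Fin n) ℝ) : Pos n)) = ((b : GL (Fin n) ℝ) : Pos n) := h
        rw [QuotientGroup.eq] at h1
        exact QuotientGroup.eq.2 h1
  · intro x
    induction x using QuotientGroup.induction_on with
    | H g =>
      obtain ⟨s, hs, hpos⟩ := exists_orthogonal_det_pos g
      refine ⟨((⟨g * s, hpos⟩ : GL(n, ℝ)⁺) : PosPlus n), ?_⟩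
      change ((g * s : GL (Fin n) ℝ) : Pos n) = (g : Pos n)
      rw [QuotientGroup.eq]
      have : (g * s)⁻¹ * g = s⁻¹ := by group
      rw [this]
      exact inv_mem hs

/-- The identification of `GL_n^+(ℝ)/SO_n(ℝ)` with `GL_n(ℝ)/O_n(ℝ)`. -/
def jEquiv (n : ℕ) : PosPlus n ≃ Pos n := Equiv.ofBijective (jMap n) (jMap_bijective n)

/-- `det(g)^{-1/n} g` in `SL_n(ℝ)`, for `g` of positive determinant. -/
def normalize {n : ℕ} (g : GL(n, ℝ)⁺) : SL(n, ℝ) :=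
  ⟨(((g : GL (Fin n) ℝ) : Mat n).det ^ (-(1 / n : ℝ))) • ((g : GL (Fin n) ℝ) : Mat n), by
    have hpos : 0 < ((g : GL (Fin n) ℝ) : Mat n).det := g.2
    rcases Nat.eq_zero_or_pos n with rfl | hn
    · simp
    · have hn' : (n : ℝ) ≠ 0 := by positivity
      rw [Matrix.det_smul, Fintype.card_fin, ← Real.rpow_natCast, ← Real.rpow_mul hpos.le]
      have : -(1 / n : ℝ) * n = -1 := by field_simp
      rw [this, Real.rpow_neg_one, inv_mul_cancel₀ hpos.ne']⟩

theorem mem_SOn_of_orthogonal {n : ℕ} {a b : GL(n, ℝ)⁺}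
    (h : (a : GL (Fin n) ℝ)⁻¹ * (b : GL (Fin n) ℝ) ∈ On n) :
    (normalize a)⁻¹ * normalize b ∈ SOn n := by
  obtain ⟨u, hu⟩ : ∃ u : GL (Fin n) ℝ, u = (a : GL (Fin n) ℝ)⁻¹ * (b : GL (Fin n) ℝ) := ⟨_, rfl⟩
  rw [← hu] at h
  have hb : (b : GL (Fin n) ℝ) = a * u := by rw [hu, mul_inv_cancel_left]
  have hbm : ((b : GL (Fin n) ℝ) : Mat n) = ((a : GL (Fin n) ℝ) : Mat n) * (u : Mat n) := by
    rw [hb, Units.val_mul]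
  have hpa : 0 < ((a : GL (Fin n) ℝ) : Mat n).det := a.2
  have hpb : 0 < ((b : GL (Fin n) ℝ) : Mat n).det := b.2
  have huu := (Matrix.mem_orthogonalGroup_iff _ _).1 h
  have hdu : (u : Mat n).det = 1 := by
    have h1 : (u : Mat n).det * (u : Mat n).det = 1 := by
      have := congrArg Matrix.det huu
      simpa using this
    have h2 : 0 < (u : Mat n).det := by
      rw [hbm, Matrix.det_mul] at hpb
      exact (pos_iff_pos_of_mul_pos hpb).1 hpa
    nlinarith
  have hdet : ((b : GL (Fin n) ℝ) : Mat n).det = ((a : GL (Fin n) ℝ) : Mat n).det := by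
    rw [hbm, Matrix.det_mul, hdu, mul_one]
  obtain ⟨v, hv⟩ : ∃ v : SL(n, ℝ), Matrix.SpecialLinearGroup.toGL v = u :=
    ⟨⟨(u : Mat n), hdu⟩, Units.ext rfl⟩
  have hvm : (v : Mat n) = (u : Mat n) := congrArg Units.val hv
  have hnb : normalize b = normalize a * v := by
    apply Subtype.ext
    change _ • _ = (_ • ((a : GL (Fin n) ℝ) : Mat n)) * (v : Mat n)
    rw [hvm, hdet, hbm, smul_mul_assoc]
  rw [hnb, inv_mul_cancel_left]
  exact Subgroup.mem_comap.2 (hv ▸ h)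

/-- `GL_n^+(ℝ)/SO_n(ℝ) → SL_n(ℝ)/SO_n(ℝ)`, `g SO_n(ℝ) ↦ det(g)^{-1/n} g SO_n(ℝ)`. -/
def pPlus (n : ℕ) : PosPlus n → SPos n :=
  Quotient.map' normalize (by
    intro a b hab
    rw [QuotientGroup.leftRel_apply] at hab ⊢
    exact mem_SOn_of_orthogonal hab)

/-- The map `p`, on `GL_n(ℝ)/O_n(ℝ)` identified with `GL_n^+(ℝ)/SO_n(ℝ)`. -/
def pMap (n : ℕ) : Pos n → SPos n := fun x => pPlus n ((jEquiv n).symm x)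

theorem pMap_mk {n : ℕ} (g : GL(n, ℝ)⁺) :
    pMap n ((g : GL (Fin n) ℝ) : Pos n) = (normalize g : SPos n) := by
  have h : (jEquiv n).symm ((g : GL (Fin n) ℝ) : Pos n) = (g : PosPlus n) :=
    (Equiv.symm_apply_eq _).2 rfl
  rw [pMap, h]
  rfl

/-- Pull-back `f ↦ f ∘ p` of smooth functions. -/
def pullP (n : ℕ) : CSPos n →ₗ[ℂ] CPos n where
  toFun f := ⟨fun x => f.1 (pMap n x), by
    intro g
    obtain ⟨s, hs, hpos⟩ := exists_orthogonal_det_pos g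
    let N : Mat n → Mat n := fun M =>
      ((M * (s : Mat n)).det ^ (-(1 / n : ℝ))) • (M * (s : Mat n))
    let W : Set (Mat n) := {M | 0 < (M * (s : Mat n)).det}
    have hdet : ContDiff ℝ ∞ fun M : Mat n => (M * (s : Mat n)).det := by
      simp only [Matrix.det_apply', Matrix.mul_apply]
      have he : ∀ i j : Fin n, ContDiff ℝ ∞ fun M : Mat n => M i j := fun i j =>
        (Matrix.entryLinearMap ℝ ℝ i j).toContinuousLinearMap.contDiff
      refine ContDiff.sum fun σ _ => ?_
      refine contDiff_const.mul ?_
      refine contDiff_prod fun i _ => ?_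
      exact ContDiff.sum fun l _ => (he _ _).mul contDiff_const
    have hW : IsOpen W := isOpen_lt continuous_const hdet.continuous
    have hN : ContDiffOn ℝ ∞ N W := by
      have hm : ContDiff ℝ ∞ fun M : Mat n => M * (s : Mat n) := contDiff_id.mul contDiff_const
      have hr : ContDiffOn ℝ ∞ (fun M : Mat n => (M * (s : Mat n)).det ^ (-(1 / n : ℝ))) W :=
        hdet.contDiffOn.rpow_const_of_ne fun M hM => (ne_of_gt hM)
      exact hr.smul hm.contDiffOn
    have key : ∀ h : GL (Fin n) ℝ, (hh : (h : Mat n) ∈ W) →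
        pMap n (h : Pos n) = (normalize ⟨h * s, hh⟩ : SPos n) := by
      intro h hh
      rw [← pMap_mk]
      congr 1
      rw [QuotientGroup.eq]
      simpa using hs
    obtain ⟨U, hU, hg, F, hF, hF'⟩ := f.2 (normalize ⟨g * s, hpos⟩)
    refine ⟨W ∩ N ⁻¹' U, hN.continuousOn.isOpen_inter_preimage hW hU, ⟨hpos, hg⟩,
      fun M => F (N M), hF.comp (hN.mono Set.inter_subset_left) fun M hM => hM.2, ?_⟩
    intro h hh
    change f.1 (pMap n (h : Pos n)) = _
    rw [key h hh.1]
    exact hF' (normalize ⟨h * s, hh.1⟩) hh.2⟩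
  map_add' _ _ := rfl
  map_smul' _ _ := rfl

/-- Pull-back `f ↦ f ∘ i` of smooth functions. -/
def pullI (n : ℕ) : CPos n →ₗ[ℂ] CSPos n where
  toFun f := ⟨fun x => f.1 (iMap n x), by
    intro g
    obtain ⟨U, hU, hg, F, hF, hF'⟩ := f.2 (Matrix.SpecialLinearGroup.toGL g)
    exact ⟨U, hU, hg, F, hF, fun h hh => hF' (Matrix.SpecialLinearGroup.toGL h) hh⟩⟩
  map_add' _ _ := rfl
  map_smul' _ _ := rfl

/-- The `SPos_n(ℝ)`-radial part `P(D) f = D(f ∘ p) ∘ i`. -/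
def radialPart {n : ℕ} (D : Module.End ℂ (CPos n)) : Module.End ℂ (CSPos n) :=
  pullI n ∘ₗ D ∘ₗ pullP n

end MaassSelberg

end

namespace MaassSelberg

/-! In exponential coordinates the map `p` is linear. For `g` of determinant one and `X` symmetric,
`det (g exp X) = exp (tr X)`, so normalizing `g exp X` multiplies it by `exp (-tr X / n)`. This
scalar is central and can be absorbed into the exponent, so `p` sends the coset of `g exp X` to that
of `g exp (π X)`, where `π X = X - (tr X / n) 1` is the orthogonal projection `traceFree` onto trace
zero matrices. Thus the chart of `f ∘ p` at `g` is the chart of `f` at `g` composed with `π`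
(`chartPos_pullP`, resting on `exp_traceFree`).

By the chain rule, differentiating `F ∘ π` in the direction `v` gives the derivative of `F` in the
direction `π v`, composed with `π` (`dirDeriv_pullL`). The `(i, j)` entry of `∂/∂X` differentiates
along `(E_ij + E_ji) / 2`, and `π` carries this to the direction of the `(i, j)` entry of `∂/∂Y`
(`traceFree_symDirHalf`). So pull-back along `π` intertwines the two matrices entry by entry, hence
also their powers (`pow_apply_intertwine`) and the traces of these. Evaluating at `X = 0`, where `π
0 = 0`, gives the formula. -/

/-! ### Pull-back along linear maps and powers of matrices of operators. -/

/-- Composition with a linear map `V → W`, from `C^∞(W)` to `C^∞(V)`. -/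
noncomputable def pullL {V W : Type*} [NormedAddCommGroup V] [NormedSpace ℝ V]
    [NormedAddCommGroup W] [NormedSpace ℝ W] [FiniteDimensional ℝ V] (L : V →ₗ[ℝ] W) :
    CInf W →ₗ[ℂ] CInf V where
  toFun F := ⟨fun x => F.1 (L x),
    mem_CInf.2 ((contDiff_CInf F).comp L.toContinuousLinearMap.contDiff)⟩
  map_add' _ _ := rfl
  map_smul' _ _ := rfl

/-- Chain rule: a linear map is its own derivative at every point, so the new direction `L v` does
not depend on the point and constant coefficients stay constant. Unlike `dirDeriv_mul_compL`, source
and target may be different spaces. -/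
theorem dirDeriv_pullL {V W : Type*} [NormedAddCommGroup V] [NormedSpace ℝ V]
    [NormedAddCommGroup W] [NormedSpace ℝ W] [FiniteDimensional ℝ V] (L : V →ₗ[ℝ] W) (v : V)
    (F : CInf W) :
    dirDeriv v (pullL L F) = pullL L (dirDeriv (L v) F) := by
  apply Subtype.ext
  funext x
  have hF : DifferentiableAt ℝ F.1 (L x) := (contDiff_CInf F).differentiable (by simp) (L x)
  have h : fderiv ℝ (fun y => F.1 (L y)) x =
      (fderiv ℝ F.1 (L x)).comp L.toContinuousLinearMap :=
    (hF.hasFDerivAt.comp x L.toContinuousLinearMap.hasFDerivAt).fderiv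
  change fderiv ℝ (fun y => F.1 (L y)) x v = fderiv ℝ F.1 (L x) (L v)
  rw [h]
  rfl

/-- If a linear map intertwines the entries of two matrices of operators, it intertwines the
entries of their powers. -/
theorem pow_apply_intertwine {n : ℕ} {R M N : Type*} [CommRing R] [AddCommGroup M] [Module R M]
    [AddCommGroup N] [Module R N] (A : Matrix (Fin n) (Fin n) (Module.End R M))
    (B : Matrix (Fin n) (Fin n) (Module.End R N)) (C : N →ₗ[R] M)
    (h : ∀ i j x, A i j (C x) = C (B i j x)) (k : ℕ) (i j : Fin n) (x : N) :
    (A ^ k) i j (C x) = C ((B ^ k) i j x) := by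
  induction k generalizing i j x with
  | zero => by_cases hij : i = j <;> simp [hij]
  | succ k ih =>
    -- In `A ^ k * A` the last factor acts first: `h` moves `C` past `A l j`, and the induction
    -- hypothesis then applies to the vector `B l j x`. This is why `x` is generalized.
    simp only [pow_succ, Matrix.mul_apply, LinearMap.sum_apply, Module.End.mul_apply, map_sum, h,
      ih]

/-! ### The projection to trace zero matrices and its exponential. -/

/-- The orthogonal projection `X ↦ X - (tr X / n) 1` of `Sym_n(ℝ)` to `SSym_n(ℝ)`. -/
noncomputable def traceFree (n : ℕ) : Sym n →ₗ[ℝ] SSym n where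
  toFun X := ⟨(X : Mat n) - ((X : Mat n).trace / n) • (1 : Mat n), by
    have hX : (X : Mat n).transpose = X := X.2
    refine Submodule.mem_inf.2 ⟨by simp [mem_Sym, hX], ?_⟩
    rcases Nat.eq_zero_or_pos n with rfl | hn
    -- For `n = 0` the trace is an empty sum, so the division by zero is harmless.
    · simp [Matrix.trace]
    · have hn' : (n : ℝ) ≠ 0 := by positivity
      simp [Matrix.trace_sub, Matrix.trace_smul, hn']⟩
  map_add' X Y := by
    apply Subtype.ext
    simp only [Submodule.coe_add, Matrix.trace_add, add_div, add_smul]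
    abel
  map_smul' c X := by
    apply Subtype.ext
    simp [Matrix.trace_smul, smul_sub, smul_smul, mul_div_assoc]

theorem coe_traceFree {n : ℕ} (X : Sym n) :
    (traceFree n X : Mat n) = (X : Mat n) - ((X : Mat n).trace / n) • (1 : Mat n) := rfl

/-- The symmetrized matrix unit has trace `δ_ij`, so the projection subtracts `δ_ij / n` times the
identity. The factor `1/2` in the off-diagonal entries of `∂/∂X` is what makes the two gradients
match here. -/
theorem traceFree_symDirHalf {n : ℕ} (i j : Fin n) :
    traceFree n (symDirHalf n i j) = ssymDir n i j := by
  apply Subtype.ext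
  have htr : (symDirHalf n i j : Mat n).trace = if i = j then 1 else 0 := by
    by_cases h : i = j
    · subst h
      simp only [symDirHalf, Matrix.trace_smul, Matrix.trace_add, Matrix.trace_single_eq_same,
        if_true, smul_eq_mul]
      norm_num
    · have h' : j ≠ i := fun e => h e.symm
      simp [symDirHalf, Matrix.trace_add, h, h', Matrix.trace_single_eq_of_ne]
  rw [coe_traceFree, htr]
  simp only [symDirHalf, ssymDir, ite_div, zero_div]

/-- Removing the trace inside the exponential is the same as dividing by the `n`-th root of the
determinant outside it, because `det (exp X) = exp (tr X)`. -/
theorem exp_traceFree {n : ℕ} (X : Sym n) :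
    NormedSpace.exp (traceFree n X : Mat n) =
      (NormedSpace.exp (X : Mat n)).det ^ (-(1 / n : ℝ)) • NormedSpace.exp (X : Mat n) := by
  -- Written as the image of a real number, the scalar part visibly commutes with `X`, so the
  -- exponential of the sum factors.
  have h1 : (traceFree n X : Mat n) =
      algebraMap ℝ (Mat n) (-((X : Mat n).trace / n)) + (X : Mat n) := by
    rw [coe_traceFree, Algebra.algebraMap_eq_smul_one, neg_smul]
    abel
  have h2 : ∀ t : ℝ, NormedSpace.exp (algebraMap ℝ (Mat n) t) =
      algebraMap ℝ (Mat n) (NormedSpace.exp t) := fun t =>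
    (NormedSpace.algebraMap_exp_comm t).symm
  rw [h1, Matrix.exp_add_of_commute _ _ (Algebra.commute_algebraMap_left _ _), h2,
    ← Algebra.smul_def, det_exp_of_mem_Sym X.2, ← Real.exp_mul, ← Real.exp_eq_exp_ℝ]
  congr 2
  ring

/-! ### The map `p` in exponential coordinates. -/

/-- In exponential coordinates, `p` is the projection to the matrices of trace zero. -/
theorem chartPos_pullP {n : ℕ} (g : SL(n, ℝ)) (f : CSPos n) :
    chartPos (Matrix.SpecialLinearGroup.toGL g) (pullP n f) =
      pullL (traceFree n) (chartSPos g f) := by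
  apply Subtype.ext
  funext X
  have hdet : ((Matrix.SpecialLinearGroup.toGL g * expGL (X : Mat n) : GL (Fin n) ℝ) : Mat n).det =
      (NormedSpace.exp (X : Mat n)).det := by
    change ((g : Mat n) * NormedSpace.exp (X : Mat n)).det = _
    rw [Matrix.det_mul, g.2, one_mul]
  -- `pMap_mk` computes `p` only on representatives of positive determinant; `g exp X` is one, so no
  -- orthogonal correction is needed.
  have hpos :
      0 < ((Matrix.SpecialLinearGroup.toGL g * expGL (X : Mat n) : GL (Fin n) ℝ) : Mat n).det := by
    rw [hdet, det_exp_of_mem_Sym X.2]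
    exact Real.exp_pos _
  have hnorm : normalize ⟨Matrix.SpecialLinearGroup.toGL g * expGL (X : Mat n), hpos⟩ =
      g * expSL (traceFree n X) := by
    apply Subtype.ext
    change ((Matrix.SpecialLinearGroup.toGL g * expGL (X : Mat n) : GL (Fin n) ℝ) : Mat n).det ^
        (-(1 / n : ℝ)) • ((g : Mat n) * NormedSpace.exp (X : Mat n)) =
      (g : Mat n) * NormedSpace.exp (traceFree n X : Mat n)
    rw [hdet, exp_traceFree, mul_smul_comm]
  change f.1 (pMap n (((⟨Matrix.SpecialLinearGroup.toGL g * expGL (X : Mat n), hpos⟩ :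
    GL(n, ℝ)⁺) : GL (Fin n) ℝ) : Pos n)) = f.1 ((g * expSL (traceFree n X) : SL(n, ℝ)) : SPos n)
  rw [pMap_mk, hnorm]

/-! ### Passing from `∂/∂X` to `∂/∂Y`. -/

theorem dX_pullL_traceFree {n : ℕ} (i j : Fin n) (F : CInf (SSym n)) :
    dX n i j (pullL (traceFree n) F) =
      pullL (traceFree n) (dY n i j F) := by
  rw [dX_apply]
  refine (dirDeriv_pullL (traceFree n) (symDirHalf n i j) F).trans ?_
  rw [traceFree_symDirHalf]
  rfl

/-- Holds already for each diagonal entry of the power; the trace is their sum and pull-back is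
additive. -/
theorem trace_dX_pow_pullL_traceFree {n : ℕ} (k : ℕ) (F : CInf (SSym n)) :
    (dX n ^ k).trace (pullL (traceFree n) F) =
      pullL (traceFree n) ((dY n ^ k).trace F) := by
  simp only [Matrix.trace, Matrix.diag_apply, LinearMap.sum_apply, map_sum]
  exact Finset.sum_congr rfl fun i _ =>
    pow_apply_intertwine _ _ _ dX_pullL_traceFree k i i F

end MaassSelberg

theorem mainTheorem6 (n k : ℕ) (f : MaassSelberg.CSPos n) (g : SL(n, ℝ)) :
    (MaassSelberg.radialPart (MaassSelberg.delta n k) f).1 (g : MaassSelberg.SPos n) =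
      ((MaassSelberg.dY n ^ k).trace (MaassSelberg.chartSPos g f)).1 0 := by
  open MaassSelberg in
  -- Unfolds `i` and `δ_k` at the coset of `g`, with `g` itself as the representative.
  change ((dX n ^ k).trace
    (chartPos (Matrix.SpecialLinearGroup.toGL g) (pullP n f))).1 0 = _
  rw [MaassSelberg.chartPos_pullP, MaassSelberg.trace_dX_pow_pullL_traceFree]
  -- A pull-back evaluated at the origin is the function evaluated at the image of the origin.
  change ((MaassSelberg.dY n ^ k).trace (MaassSelberg.chartSPos g f)).1
    (MaassSelberg.traceFree n 0) = _
  rw [map_zero]
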